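/- **Definitions.** Let $\Sigma$ and $\Delta$ be finite alphabets (possibly different, possibly overlapping) and let $f$ be a partial function from $\Sigma^*$ to $\Delta^*$. For strings $x=x_1\ldots x_m$ and $y=y_1\ldots y_n$ and a symbol $\boxdot\notin\Sigma\cup\Delta$, the convolution $\mathrm{conv}(x,y)$ is the word $(x'_1,y'_1)\ldots(x'_k,y'_k)$ with $k=\max\{m,n\}$, where $x'_i=x_i$ for $i\le m$ and $x'_i=\boxdot$ otherwise, and similarly for $y'_i$. The function $f$ is *automatic* if $\{\mathrm{conv}(x,f(x)) : x\in\mathrm{dom}(f)\}$ is a regular language. A *position-faithful one-tape Turing machine* (with finitely many states and tape symbols) works on a one-side infinite tape whose leftmost cell holds a marker $\boxplus$, which occurs only there and cannot be modified. It starts with the head on $\boxplus$ and tape content $\boxplus x\boxdot^\infty$, where $x\in\Sigma^*$ is the input. It halts when it enters an accepting state; it may also halt without accepting. It *computes* $f$ if for each $x\in\Sigma^*$: some computation on input $x$ reaches an accepting state if and only if $x\in\mathrm{dom}(f)$, and each computation on input $x$ that reaches an accepting state ends with a tape content starting with $\boxplus f(x)\boxdot$. It does so *in linear time* if there is a constant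 $c$ such that, for each $x\in\Sigma^*$, each computation on input $x$, accepting or not, makes at most $c\cdot(|x|+1)$ steps. The machine is *deterministic* if at most one transition applies in each situation. **Theorem.** If $f$ is computed by a non-deterministic position-faithful one-tape Turing machine in linear time, then $f$ is automatic. Moreover, the following are equivalent: 1. $f$ is automatic; 2. $f$ is computed in linear time by a deterministic position-faithful one-tape Turing machine; 3. $f$ is computed in linear time by a non-deterministic position-faithful one-tape Turing machine. -/

import Mathlib

/-! ### Convolution and automatic functions -/

/-- The convolution of two strings. The padding symbol is `none`; a symbol `a` of one of the two
alphabets appears as `some a`. The `i`-th letter is the pair of the `i`-th letters of `x` and `y`,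
a letter that lies beyond the end of its string being replaced by the padding symbol. -/
def conv {α β : Type*} (x : List α) (y : List β) : List (Option α × Option β) :=
  (List.range (max x.length y.length)).map fun i => (x[i]?, y[i]?)

/-- The set of the convolutions `conv x (f x)` for `x` in the domain of the partial function `f`. -/
def graphLanguage {α β : Type*} (f : List α →. List β) : Language (Option α × Option β) :=
  {w | ∃ x : List α, ∃ y ∈ f x, w = conv x y}

/-- A partial function from strings to strings is automatic if the convolutions of its
argument-value pairs form a regular language. -/
def IsAutomatic {α β : Type*} (f : List α →. List β) : Prop :=
  (graphLanguage f).IsRegular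

/-! ### Position-faithful one-tape Turing machines -/

/-- What a tape cell can hold: the left-end marker, the blank, an ordinary symbol from `S`, or an
auxiliary symbol from `W`. -/
inductive TapeSymbol (S W : Type*) where
  | leftEnd : TapeSymbol S W
  | blank : TapeSymbol S W
  | sym (s : S) : TapeSymbol S W
  | work (w : W) : TapeSymbol S W

/-- Head movements. -/
inductive Move where
  | left : Move
  | stay : Move
  | right : Move

/-- The new head position. (A left move is never made from cell `0`, see `OneTapeTM`.) -/
def Move.apply : Move → ℕ → ℕ
  | Move.left, k => k - 1
  | Move.stay, k => k
  | Move.right, k => k + 1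

/-- A (non-deterministic) one-tape Turing machine on a one-side infinite tape whose left end
carries a marker. `trans q a p b d` says that in state `q`, scanning the symbol `a`, the machine
may go to state `p`, write `b`, and move its head by `d`. -/
structure OneTapeTM (S : Type*) where
  /-- the auxiliary tape symbols -/
  Work : Type
  /-- the states -/
  State : Type
  finite_work : Finite Work
  finite_state : Finite State
  start : State
  accept : Set State
  trans : State → TapeSymbol S Work → State → TapeSymbol S Work → Move → Prop
  /-- the marker is never overwritten and never written elsewhere -/
  leftEnd_iff : ∀ q a p b d, trans q a p b d →
    (a = TapeSymbol.leftEnd ↔ b = TapeSymbol.leftEnd)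
  /-- the head never moves left of the marker -/
  not_left : ∀ q p b, ¬ trans q TapeSymbol.leftEnd p b Move.left

namespace OneTapeTM

variable {S : Type*} (M : OneTapeTM S)

/-- The machine is deterministic: at most one transition applies in each situation. -/
def IsDeterministic : Prop :=
  ∀ q a p b d p' b' d', M.trans q a p b d → M.trans q a p' b' d' → p = p' ∧ b = b' ∧ d = d'

/-- A configuration: state, head position, and tape content. Cell `0` is the left end. -/
structure Config where
  state : M.State
  head : ℕ
  tape : ℕ → TapeSymbol S M.Work

/-- The initial tape for the input `x`: the marker in cell `0`, then `x`, then blanks. -/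
def initialTape (x : List S) : ℕ → TapeSymbol S M.Work
  | 0 => TapeSymbol.leftEnd
  | i + 1 => (x[i]?).elim TapeSymbol.blank TapeSymbol.sym

/-- The initial configuration for the input `x`: start state, head on the marker. -/
def initialConfig (x : List S) : M.Config where
  state := M.start
  head := 0
  tape := M.initialTape x

/-- One computation step. There is no step out of an accepting state. -/
def Step (c c' : M.Config) : Prop :=
  c.state ∉ M.accept ∧ ∃ b d, M.trans c.state (c.tape c.head) c'.state b d ∧
    c'.tape = Function.update c.tape c.head b ∧ c'.head = d.apply c.head

/-- `M.Reaches x n c`: some computation of `M` on input `x` is in configuration `c` after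
exactly `n` steps. -/
inductive Reaches (x : List S) : ℕ → M.Config → Prop where
  | zero : Reaches x 0 (M.initialConfig x)
  | succ {n : ℕ} {c c' : M.Config} : Reaches x n c → M.Step c c' → Reaches x (n + 1) c'

/-- The tape content starts with the marker, followed by `y`, followed by a blank. Nothing is
required of the cells to the right of that blank. -/
def HasOutput (c : M.Config) (y : List S) : Prop :=
  c.tape 0 = TapeSymbol.leftEnd ∧
  (∀ (i : ℕ) (h : i < y.length), c.tape (i + 1) = TapeSymbol.sym y[i]) ∧
  c.tape (y.length + 1) = TapeSymbol.blank

/-- `M` computes the partial function `f` from strings over `A` to strings over `B`: on an input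
`x`, some computation accepts iff `x` is in the domain of `f`, and each accepting computation
produces the output `f x`. -/
def Computes {A B : Set S} (f : List A →. List B) : Prop :=
  ∀ x : List A,
    ((∃ n c, M.Reaches (x.map Subtype.val) n c ∧ c.state ∈ M.accept) ↔ (f x).Dom) ∧
    ∀ n c, M.Reaches (x.map Subtype.val) n c → c.state ∈ M.accept →
      ∀ y ∈ f x, M.HasOutput c (y.map Subtype.val)

/-- `M` runs in linear time on inputs over `A`: for some constant `k`, each computation, accepting
or not, on each input `x` makes at most `k * (|x| + 1)` steps. -/
def LinearTime (A : Set S) : Prop :=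
  ∃ k : ℕ, ∀ (x : List A) (n : ℕ) (c : M.Config),
    M.Reaches (x.map Subtype.val) n c → n ≤ k * (x.length + 1)

end OneTapeTM

/-- `f` is computed in linear time by a deterministic position-faithful one-tape machine. -/
def DetLinearTimeComputable {S : Type*} {A B : Set S} (f : List A →. List B) : Prop :=
  ∃ M : OneTapeTM S, M.IsDeterministic ∧ M.Computes f ∧ M.LinearTime A

/-- `f` is computed in linear time by a non-deterministic position-faithful one-tape machine. -/
def NondetLinearTimeComputable {S : Type*} {A B : Set S} (f : List A →. List B) : Prop :=
  ∃ M : OneTapeTM S, M.Computes f ∧ M.LinearTime A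

/-!
A machine that runs in linear time has crossing sequences of bounded length. The crossing sequence
of a boundary between two cells is the list of the states in which the head crosses it. An accepting
computation is the same thing as a choice of one crossing sequence for each boundary that is
consistent at each single cell (`OneTapeTM.Local`): the sequences of a computation are consistent
(`OneTapeTM.Run.exists_isCrossing`), and consistent sequences can be put together to a computation
that makes a step for each entry (`OneTapeTM.IsCrossing.exists_run`). As consistency is local, the
cells between two boundaries with equal crossing sequences can be cut out
(`OneTapeTM.IsCrossing.cut`). In linear time the average crossing sequence over the input is
bounded, hence a long input has many boundaries with short crossing sequences, and among them two
equal ones on the same side of any prescribed boundary. So the input can be shortened without losing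
the prescribed crossing sequence, whose length is therefore bounded by the case of short inputs
(`OneTapeTM.LinearTime.exists_length_le`). A nondeterministic finite automaton that reads the
convolution of argument and value can then guess the crossing sequences one after the other and
check their consistency; instead of an automaton, the proof exhibits a finite family of languages
that is closed under quotients by letters up to unions (`OneTapeTM.cons_mem_tailLanguage`).

Conversely, let an automaton for the graph of `f` be given. A deterministic machine
(`OneTapeTM.passMachine`) passes over the argument to the right and stores in each cell the set of
states that the automaton can reach there for some value. At the end it knows whether the value
exists, and it selects one of finitely many words to be written beyond the argument. Then it moves
back to the left and reconstructs an accepting run, replacing each letter of the argument by the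
letter of the value at this position. Any accepting run yields the value, since the accepted word
has to be the convolution of the argument with the value.
-/

namespace OneTapeTM

variable {S : Type*} (M : OneTapeTM S)

/-! ### Computations from an arbitrary configuration -/

/-- `M.Run n c c'`: the machine can go from `c` to `c'` in exactly `n` steps. In contrast to
`Reaches`, the induction is on the first step. -/
inductive Run : ℕ → M.Config → M.Config → Prop
  | refl (c : M.Config) : Run 0 c c
  | head {n : ℕ} {c c' c'' : M.Config} : M.Step c c' → Run n c' c'' → Run (n + 1) c c''

variable {M}

theorem Run.trans {m n : ℕ} {c c' c'' : M.Config} (h : M.Run m c c') (h' : M.Run n c' c'') :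
    M.Run (m + n) c c'' := by
  induction h with
  | refl => simpa using h'
  | @head k _ _ _ hs _ ih =>
    have := Run.head hs (ih h')
    rwa [Nat.add_right_comm] at this

theorem Run.single {c c' : M.Config} (h : M.Step c c') : M.Run 1 c c' :=
  .head h (.refl _)

theorem reaches_iff_run {x : List S} {n : ℕ} {c : M.Config} :
    M.Reaches x n c ↔ M.Run n (M.initialConfig x) c := by
  constructor
  · intro h
    induction h with
    | zero => exact .refl _
    | succ _ hs ih => exact ih.trans (.single hs)
  · suffices H : ∀ (m : ℕ) (c₀ : M.Config), M.Run n c₀ c → M.Reaches x m c₀ →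
        M.Reaches x (m + n) c by
      intro h
      simpa using H 0 _ h .zero
    intro m c₀ h
    induction h generalizing m with
    | refl => exact id
    | @head k _ _ _ hs _ ih =>
      intro hr
      have := ih (m + 1) (.succ hr hs)
      rwa [Nat.add_right_comm] at this

/-! ### Crossing sequences -/

/-- Where the head is, as seen from a fixed cell: to the left of it, to the right of it, or on it,
the machine being in state `q`. -/
inductive CellMode (M : OneTapeTM S) where
  | left : CellMode M
  | right : CellMode M
  | here (q : M.State) : CellMode M

variable (M) in
/-- The part of an accepting computation that a single cell sees. `M.Local m l a r b` says that,
from the situation `m` of the head on, the cell with current content `a` can end with content `b`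
if `l` and `r` are the crossing sequences of its left and right boundary, that is, the lists of the
states in which the head crosses the boundary, in either direction and in temporal order. -/
inductive Local : CellMode M → List M.State → TapeSymbol S M.Work → List M.State →
    TapeSymbol S M.Work → Prop
  | doneLeft (a) : Local .left [] a [] a
  | doneRight (a) : Local .right [] a [] a
  | accept {q} (a) : q ∈ M.accept → Local (.here q) [] a [] a
  | enterLeft {q l a r b} : Local (.here q) l a r b → Local .left (q :: l) a r b
  | enterRight {q l a r b} : Local (.here q) l a r b → Local .right l a (q :: r) b
  | stay {q p l a a' r b} : q ∉ M.accept → M.trans q a p a' .stay →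
      Local (.here p) l a' r b → Local (.here q) l a r b
  | exitLeft {q p l a a' r b} : q ∉ M.accept → M.trans q a p a' .left →
      Local .left l a' r b → Local (.here q) (p :: l) a r b
  | exitRight {q p l a a' r b} : q ∉ M.accept → M.trans q a p a' .right →
      Local .right l a' r b → Local (.here q) l a (p :: r) b

/-- The situation of the head as seen from cell `i` if the head is on cell `h` in state `q`. -/
def modeAt (q : M.State) (h i : ℕ) : CellMode M :=
  if i < h then .right else if i = h then .here q else .left

theorem modeAt_lt {q : M.State} {h i : ℕ} (hi : i < h) : modeAt q h i = .right := by
  simp [modeAt, hi]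

theorem modeAt_self (q : M.State) (h : ℕ) : modeAt q h h = .here q := by simp [modeAt]

theorem modeAt_gt {q : M.State} {h i : ℕ} (hi : h < i) : modeAt q h i = .left := by
  simp [modeAt, hi.not_gt, hi.ne']

variable (M) in
/-- `M.IsCrossing a b c`: the sequence `c` of crossing sequences (`c i` belongs to the boundary to
the left of cell `i`) is locally consistent at each cell and leads from the tape content `a` to the
tape content `b`. The head is imagined to enter cell `0` from the left at the beginning, so that all
cells are subject to the same condition. -/
structure IsCrossing (a b : ℕ → TapeSymbol S M.Work) (c : ℕ → List M.State) : Prop where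
  zero : c 0 = [M.start]
  eventually : ∃ N, ∀ i ≥ N, c i = []
  cell : ∀ i, M.Local .left (c i) (a i) (c (i + 1)) (b i)

/-- The crossing sequences of the remaining part of an accepting computation. -/
theorem Run.exists_crossing {n : ℕ} {d d' : M.Config} (h : M.Run n d d')
    (hacc : d'.state ∈ M.accept) (h0 : d.tape 0 = .leftEnd) :
    ∃ c : ℕ → List M.State, c 0 = [] ∧ (∃ N, ∀ i ≥ N, c i = []) ∧
      ∀ i, M.Local (modeAt d.state d.head i) (c i) (d.tape i) (c (i + 1)) (d'.tape i) := by
  induction h with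
  | refl d =>
    refine ⟨fun _ => [], rfl, ⟨0, fun _ _ => rfl⟩, fun i => ?_⟩
    rcases lt_trichotomy i d.head with hi | rfl | hi
    · rw [modeAt_lt hi]; exact .doneRight _
    · rw [modeAt_self]; exact .accept _ hacc
    · rw [modeAt_gt hi]; exact .doneLeft _
  | @head n d e d' hs _ ih =>
    obtain ⟨q, h, t⟩ := d
    obtain ⟨p, h', t'⟩ := e
    obtain ⟨hq, b, m, htr, ht, hh⟩ := hs
    dsimp only at *
    have ht0 : t' 0 = .leftEnd := by
      subst ht
      by_cases h00 : h = 0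
      · subst h00
        rw [Function.update_self]
        exact (M.leftEnd_iff _ _ _ _ _ htr).1 h0
      · rw [Function.update_of_ne (Ne.symm h00)]
        exact h0
    obtain ⟨c, hc0, ⟨N, hN⟩, hc⟩ := ih hacc ht0
    -- A move of the head puts the new state in front of the crossing sequence of one boundary.
    have hself := hc h
    rw [ht, Function.update_self] at hself
    cases m with
    | stay =>
      obtain rfl : h' = h := hh
      refine ⟨c, hc0, ⟨N, hN⟩, fun i => ?_⟩
      have hci := hc i
      rcases lt_trichotomy i h' with hi | rfl | hi
      · rw [modeAt_lt hi] at hci ⊢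
        rwa [ht, Function.update_of_ne hi.ne] at hci
      · rw [modeAt_self] at hself ⊢
        exact .stay hq htr hself
      · rw [modeAt_gt hi] at hci ⊢
        rwa [ht, Function.update_of_ne hi.ne'] at hci
    | right =>
      obtain rfl : h' = h + 1 := hh
      refine ⟨Function.update c (h + 1) (p :: c (h + 1)), ?_, ⟨max N (h + 2), fun i hi => ?_⟩,
        fun i => ?_⟩
      · rwa [Function.update_of_ne (by omega)]
      · rw [Function.update_of_ne (by omega)]
        exact hN i (by omega)
      have hci := hc i
      rcases lt_trichotomy i h with hi | rfl | hi
      · rw [modeAt_lt hi, Function.update_of_ne (by omega), Function.update_of_ne (by omega)]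
        rwa [modeAt_lt (by omega), ht, Function.update_of_ne hi.ne] at hci
      · rw [modeAt_self, Function.update_of_ne (by omega), Function.update_self]
        rw [modeAt_lt (by omega)] at hself
        exact .exitRight hq htr hself
      · rw [modeAt_gt hi, Function.update_of_ne (show i + 1 ≠ h + 1 by omega)]
        rw [ht, Function.update_of_ne hi.ne'] at hci
        rcases eq_or_lt_of_le (Nat.succ_le_of_lt hi) with rfl | hi'
        · rw [Nat.succ_eq_add_one, modeAt_self] at hci
          rw [Nat.succ_eq_add_one, Function.update_self]
          exact .enterLeft hci
        · rw [Function.update_of_ne (by omega)]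
          rwa [modeAt_gt hi'] at hci
    | left =>
      have h00 : h ≠ 0 := by
        rintro rfl
        rw [h0] at htr
        exact M.not_left _ _ _ htr
      obtain ⟨k, rfl⟩ := Nat.exists_eq_succ_of_ne_zero h00
      obtain rfl : h' = k := hh
      rw [Nat.succ_eq_add_one] at *
      refine ⟨Function.update c (h' + 1) (p :: c (h' + 1)), ?_, ⟨max N (h' + 2), fun i hi => ?_⟩,
        fun i => ?_⟩
      · rwa [Function.update_of_ne (by omega)]
      · rw [Function.update_of_ne (by omega)]
        exact hN i (by omega)
      have hci := hc i
      rcases lt_trichotomy i (h' + 1) with hi | rfl | hi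
      · rw [modeAt_lt hi, Function.update_of_ne (show i ≠ h' + 1 by omega)]
        rw [ht, Function.update_of_ne hi.ne] at hci
        rcases eq_or_lt_of_le (Nat.lt_succ_iff.1 hi) with rfl | hi'
        · rw [modeAt_self] at hci
          rw [Function.update_self]
          exact .enterRight hci
        · rw [Function.update_of_ne (by omega)]
          rwa [modeAt_lt hi'] at hci
      · rw [modeAt_self, Function.update_self, Function.update_of_ne (by omega)]
        rw [modeAt_gt (by omega)] at hself
        exact .exitLeft hq htr hself
      · rw [modeAt_gt hi, Function.update_of_ne (by omega), Function.update_of_ne (by omega)]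
        rwa [modeAt_gt (by omega), ht, Function.update_of_ne hi.ne'] at hci

/-- An accepting computation has a locally consistent sequence of crossing sequences. -/
theorem Run.exists_isCrossing {n : ℕ} {x : List S} {d : M.Config}
    (h : M.Run n (M.initialConfig x) d) (hacc : d.state ∈ M.accept) :
    ∃ c, M.IsCrossing (M.initialTape x) d.tape c := by
  obtain ⟨c, hc0, ⟨N, hN⟩, hc⟩ := h.exists_crossing hacc rfl
  change ∀ i, M.Local (modeAt M.start 0 i) (c i) (M.initialTape x i) (c (i + 1)) (d.tape i) at hc
  refine ⟨Function.update c 0 [M.start], by simp, ⟨N + 1, fun i hi => ?_⟩, fun i => ?_⟩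
  · rw [Function.update_of_ne (by omega)]
    exact hN i (by omega)
  · rw [Function.update_of_ne (show i + 1 ≠ 0 by omega)]
    have hci := hc i
    rcases Nat.eq_zero_or_pos i with rfl | hi
    · rw [Function.update_self]
      rw [hc0] at hci
      exact .enterLeft hci
    · rw [Function.update_of_ne hi.ne']
      rwa [modeAt_gt hi] at hci

theorem Local.left_nil {a b : TapeSymbol S M.Work} {r : List M.State}
    (h : M.Local .left [] a r b) : r = [] ∧ b = a := by
  cases h; exact ⟨rfl, rfl⟩

theorem Local.right_nil {a b : TapeSymbol S M.Work} {l : List M.State}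
    (h : M.Local .right l a [] b) : l = [] ∧ b = a := by
  cases h; exact ⟨rfl, rfl⟩

theorem Local.left_cons {q : M.State} {l r : List M.State} {a b : TapeSymbol S M.Work}
    (h : M.Local .left (q :: l) a r b) : M.Local (.here q) l a r b := by
  cases h; assumption

theorem Local.right_cons {q : M.State} {l r : List M.State} {a b : TapeSymbol S M.Work}
    (h : M.Local .right l a (q :: r) b) : M.Local (.here q) l a r b := by
  cases h; assumption

/-- While the head is on a cell, the machine makes some steps without moving and then accepts, or
leaves the cell. -/
theorem Local.here_cases {q : M.State} {l r : List M.State} {a b : TapeSymbol S M.Work}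
    (hl : M.Local (.here q) l a r b) :
    ∃ q' a', (∀ (h : ℕ) (t : ℕ → TapeSymbol S M.Work), t h = a →
        ∃ m, M.Run m ⟨q, h, t⟩ ⟨q', h, Function.update t h a'⟩) ∧
      ((q' ∈ M.accept ∧ l = [] ∧ r = [] ∧ b = a') ∨
       (q' ∉ M.accept ∧ ∃ p a'' l', M.trans q' a' p a'' .left ∧ l = p :: l' ∧
          M.Local .left l' a'' r b) ∨
       (q' ∉ M.accept ∧ ∃ p a'' r', M.trans q' a' p a'' .right ∧ r = p :: r' ∧
          M.Local .right l a'' r' b)) := by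
  generalize hm : CellMode.here q = m at hl
  induction hl generalizing q with
  | doneLeft => cases hm
  | doneRight => cases hm
  | enterLeft => cases hm
  | enterRight => cases hm
  | @accept q₁ a hq =>
    cases hm
    refine ⟨q₁, a, fun h t ht => ⟨0, ?_⟩, .inl ⟨hq, rfl, rfl, rfl⟩⟩
    subst ht
    rw [Function.update_eq_self]
    exact .refl _
  | @stay q₁ p _ _ a₁ _ _ hq htr _ ih =>
    cases hm
    obtain ⟨q', a', hrun, hrest⟩ := ih rfl
    refine ⟨q', a', fun h t ht => ?_, hrest⟩
    obtain ⟨m, hm⟩ := hrun h (Function.update t h a₁) (Function.update_self ..)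
    rw [Function.update_idem] at hm
    subst ht
    have hstep : M.Step ⟨q₁, h, t⟩ ⟨p, h, Function.update t h a₁⟩ :=
      ⟨hq, a₁, .stay, htr, rfl, rfl⟩
    exact ⟨m + 1, .head hstep hm⟩
  | @exitLeft q₁ p l' a₀ a₁ _ _ hq htr hl _ =>
    cases hm
    refine ⟨q₁, a₀, fun h t ht => ⟨0, ?_⟩, .inr (.inl ⟨hq, p, a₁, l', htr, rfl, hl⟩)⟩
    subst ht
    rw [Function.update_eq_self]
    exact .refl _
  | @exitRight q₁ p _ a₀ a₁ r' _ hq htr hl _ =>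
    cases hm
    refine ⟨q₁, a₀, fun h t ht => ⟨0, ?_⟩, .inr (.inr ⟨hq, p, a₁, r', htr, rfl, hl⟩)⟩
    subst ht
    rw [Function.update_eq_self]
    exact .refl _

/-- Locally consistent crossing sequences can be put together to a computation, which makes at least
one step for each entry of a crossing sequence. -/
theorem exists_run_of_crossing (b : ℕ → TapeSymbol S M.Work) (N T : ℕ) (q : M.State) (h : ℕ)
    (t : ℕ → TapeSymbol S M.Work) (c : ℕ → List M.State) (hc0 : c 0 = [])
    (hN : ∀ i ≥ N, c i = []) (hT : ∑ i ∈ Finset.range N, (c i).length = T)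
    (hc : ∀ i, M.Local (modeAt q h i) (c i) (t i) (c (i + 1)) (b i)) :
    ∃ m d, M.Run m ⟨q, h, t⟩ d ∧ d.state ∈ M.accept ∧ d.tape = b ∧ T ≤ m := by
  induction T generalizing q h t c with
  | zero =>
    have hnil : ∀ i, c i = [] := fun i => by
      by_cases hi : N ≤ i
      · exact hN i hi
      · exact List.length_eq_zero_iff.1 (Finset.sum_eq_zero_iff.1 hT i (by simpa using hi))
    have hh := hc h
    rw [modeAt_self] at hh
    obtain ⟨q', a', hrun, ⟨hacc, -, -, hb⟩ | ⟨-, p, a'', l', -, h1, -⟩ |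
      ⟨-, p, a'', l', -, h1, -⟩⟩ := hh.here_cases
    · obtain ⟨m, hm⟩ := hrun h t rfl
      refine ⟨m, _, hm, hacc, funext fun i => ?_, Nat.zero_le _⟩
      have hci := hc i
      rw [hnil i, hnil (i + 1)] at hci
      rcases lt_trichotomy i h with hi | rfl | hi
      · rw [modeAt_lt hi] at hci
        simpa [Function.update_of_ne hi.ne] using hci.right_nil.2.symm
      · simpa using hb.symm
      · rw [modeAt_gt hi] at hci
        simpa [Function.update_of_ne hi.ne'] using hci.left_nil.2.symm
    · simp [hnil] at h1
    · simp [hnil] at h1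
  | succ T ih =>
    -- Dropping the first entry of a crossing sequence lowers the total length by one.
    have hsum : ∀ k p l, c k = p :: l →
        (∀ i ≥ N, Function.update c k l i = []) ∧
        ∑ i ∈ Finset.range N, (Function.update c k l i).length = T := by
      intro k p l hk
      have hkN : k < N := by
        by_contra hcon
        rw [hN k (by omega)] at hk
        cases hk
      refine ⟨fun i hi => ?_, ?_⟩
      · rw [Function.update_of_ne (by omega)]
        exact hN i hi
      · have hmem : k ∈ Finset.range N := by simpa using hkN
        rw [← Finset.add_sum_erase _ _ hmem] at hT ⊢
        rw [Function.update_self]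
        rw [hk, List.length_cons] at hT
        have : ∑ i ∈ (Finset.range N).erase k, (Function.update c k l i).length =
            ∑ i ∈ (Finset.range N).erase k, (c i).length :=
          Finset.sum_congr rfl fun i hi => by
            rw [Function.update_of_ne (Finset.ne_of_mem_erase hi)]
        omega
    have hh := hc h
    rw [modeAt_self] at hh
    obtain ⟨q', a', hrun, ⟨hacc, h1, h2, -⟩ | ⟨hq', p, a'', l', htr, h1, hl⟩ |
      ⟨hq', p, a'', l', htr, h1, hl⟩⟩ := hh.here_cases
    · exfalso
      -- Once the machine has accepted, empty crossing sequences spread from cell `h`.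
      have hright : ∀ k, c (h + 1 + k) = [] := by
        intro k
        induction k with
        | zero => exact h2
        | succ k ihk =>
          have hci := hc (h + 1 + k)
          rw [ihk, modeAt_gt (by omega)] at hci
          exact hci.left_nil.1
      have hleft : ∀ k, c (h - k) = [] := by
        intro k
        induction k with
        | zero => exact h1
        | succ k ihk =>
          by_cases hk : k < h
          · have hci := hc (h - (k + 1))
            rw [show h - (k + 1) + 1 = h - k by omega, ihk, modeAt_lt (by omega)] at hci
            exact hci.right_nil.1
          · rwa [show h - (k + 1) = h - k by omega]
      have hnil : ∀ i, c i = [] := fun i => by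
        by_cases hi : i ≤ h
        · simpa [Nat.sub_sub_self hi] using hleft (h - i)
        · simpa [show h + 1 + (i - (h + 1)) = i by omega] using hright (i - (h + 1))
      simp [hnil] at hT
    · obtain ⟨m, hm⟩ := hrun h t rfl
      have h00 : h ≠ 0 := by
        rintro rfl
        rw [hc0] at h1
        cases h1
      obtain ⟨k, rfl⟩ := Nat.exists_eq_succ_of_ne_zero h00
      rw [Nat.succ_eq_add_one] at *
      obtain ⟨hN', hT'⟩ := hsum _ _ _ h1
      obtain ⟨m', d, hd, hacc, htape, hle⟩ := ih p k (Function.update t (k + 1) a'')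
        (Function.update c (k + 1) l') (by rwa [Function.update_of_ne (by omega)]) hN' hT' (by
          intro i
          have hci := hc i
          rcases lt_trichotomy i (k + 1) with hi | rfl | hi
          · rw [modeAt_lt hi] at hci
            rw [Function.update_of_ne hi.ne, Function.update_of_ne hi.ne]
            rcases eq_or_lt_of_le (Nat.lt_succ_iff.1 hi) with rfl | hi'
            · rw [Function.update_self, modeAt_self]
              rw [h1] at hci
              exact hci.right_cons
            · rwa [Function.update_of_ne (by omega), modeAt_lt hi']
          · rw [modeAt_gt (by omega), Function.update_self, Function.update_self,
              Function.update_of_ne (by omega)]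
            exact hl
          · rw [modeAt_gt hi] at hci
            rwa [modeAt_gt (by omega), Function.update_of_ne hi.ne', Function.update_of_ne hi.ne',
              Function.update_of_ne (by omega)])
      refine ⟨m + (m' + 1), d, hm.trans (.head ⟨hq', a'', .left, ?_, ?_, rfl⟩ hd), hacc, htape,
        by omega⟩
      · simpa using htr
      · simp
    · obtain ⟨m, hm⟩ := hrun h t rfl
      obtain ⟨hN', hT'⟩ := hsum _ _ _ h1
      obtain ⟨m', d, hd, hacc, htape, hle⟩ := ih p (h + 1) (Function.update t h a'')
        (Function.update c (h + 1) l') (by rwa [Function.update_of_ne (by omega)]) hN' hT' (by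
          intro i
          have hci := hc i
          rcases lt_trichotomy i h with hi | rfl | hi
          · rw [modeAt_lt hi] at hci
            rwa [modeAt_lt (by omega), Function.update_of_ne hi.ne,
              Function.update_of_ne (by omega), Function.update_of_ne (by omega)]
          · rw [modeAt_lt (by omega), Function.update_self, Function.update_self,
              Function.update_of_ne (by omega)]
            exact hl
          · rw [modeAt_gt hi] at hci
            rw [Function.update_of_ne (show i ≠ h by omega),
              Function.update_of_ne (show i + 1 ≠ h + 1 by omega)]
            rcases eq_or_lt_of_le (Nat.succ_le_of_lt hi) with rfl | hi'
            · rw [Nat.succ_eq_add_one] at *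
              rw [Function.update_self, modeAt_self]
              rw [h1] at hci
              exact hci.left_cons
            · rwa [Function.update_of_ne (by omega), modeAt_gt hi'])
      refine ⟨m + (m' + 1), d, hm.trans (.head ⟨hq', a'', .right, ?_, ?_, rfl⟩ hd), hacc, htape,
        by omega⟩
      · simpa using htr
      · simp

/-- Locally consistent crossing sequences for an input `x` come from an accepting computation on
`x`, which is as long as the crossing sequences are in total, up to the fictitious first entry. -/
theorem IsCrossing.exists_run {x : List S} {b : ℕ → TapeSymbol S M.Work} {c : ℕ → List M.State}
    (h : M.IsCrossing (M.initialTape x) b c) :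
    ∃ m d, M.Run m (M.initialConfig x) d ∧ d.state ∈ M.accept ∧ d.tape = b ∧
      ∀ N, ∑ i ∈ Finset.range N, (c i).length ≤ m + 1 := by
  obtain ⟨N, hN⟩ := h.eventually
  obtain ⟨m, d, hd, hacc, htape, hle⟩ := exists_run_of_crossing b (N + 1) _ M.start 0
    (M.initialTape x) (Function.update c 0 []) (Function.update_self ..)
    (fun i hi => by rw [Function.update_of_ne (by omega)]; exact hN i (by omega)) rfl
    (fun i => by
      have hci := h.cell i
      rw [Function.update_of_ne (show i + 1 ≠ 0 by omega)]
      rcases Nat.eq_zero_or_pos i with rfl | hi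
      · rw [h.zero] at hci
        rw [Function.update_self, modeAt_self]
        exact hci.left_cons
      · rwa [Function.update_of_ne hi.ne', modeAt_gt hi])
  refine ⟨m, d, hd, hacc, htape, fun N' => ?_⟩
  have h1 : ∑ i ∈ Finset.range N', (c i).length ≤ ∑ i ∈ Finset.range (N + 1), (c i).length := by
    by_cases hN' : N' ≤ N + 1
    · exact Finset.sum_le_sum_of_subset (Finset.range_subset_range.2 hN')
    · refine (Finset.sum_subset (Finset.range_subset_range.2 (by omega)) fun i _ hi => ?_).ge
      rw [hN i (by simp at hi; omega)]
      rfl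
  rw [Finset.sum_range_succ'] at h1 hle
  simp only [h.zero, Function.update_self, List.length_nil, List.length_cons] at h1 hle
  have h2 : ∑ i ∈ Finset.range N, (Function.update c 0 [] (i + 1)).length =
      ∑ i ∈ Finset.range N, (c (i + 1)).length :=
    Finset.sum_congr rfl fun i _ => by rw [Function.update_of_ne (by omega)]
  omega

end OneTapeTM

namespace OneTapeTM

variable {S : Type*} {M : OneTapeTM S}

/-! ### Linear time bounds the length of crossing sequences -/

theorem initialTape_succ (x : List S) (k : ℕ) :
    M.initialTape x (k + 1) = (x[k]?).elim .blank .sym := rfl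

theorem initialTape_cut (x : List S) {i j : ℕ} (hij : i < j) (hj : j ≤ x.length) (k : ℕ) :
    M.initialTape (x.take i ++ x.drop j) k =
      if k < i + 1 then M.initialTape x k else M.initialTape x (k + (j - i)) := by
  cases k with
  | zero => rfl
  | succ k =>
    rw [show k + 1 + (j - i) = k + (j - i) + 1 by omega]
    simp only [initialTape_succ, List.getElem?_append, List.length_take]
    by_cases hk : k < i
    · rw [if_pos (by omega), if_pos (by omega), List.getElem?_take_of_lt hk]
    · rw [if_neg (by omega), if_neg (by omega), List.getElem?_drop]
      congr 2
      omega

/-- If two boundaries within the input have the same crossing sequence, then the cells between them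
can be cut out. -/
theorem IsCrossing.cut {x : List S} {b : ℕ → TapeSymbol S M.Work} {c : ℕ → List M.State}
    (h : M.IsCrossing (M.initialTape x) b c) {i j : ℕ} (hij : i < j) (hj : j ≤ x.length)
    (hc : c (i + 1) = c (j + 1)) :
    M.IsCrossing (M.initialTape (x.take i ++ x.drop j))
      (fun k => if k < i + 1 then b k else b (k + (j - i)))
      (fun k => if k < i + 1 then c k else c (k + (j - i))) where
  zero := by simpa using h.zero
  eventually := by
    obtain ⟨N, hN⟩ := h.eventually
    refine ⟨N + (i + 1), fun k hk => ?_⟩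
    rw [if_neg (by omega)]
    exact hN _ (by omega)
  cell := fun k => by
    rw [initialTape_cut x hij hj]
    rcases lt_trichotomy k i with hk | rfl | hk
    · simp only [if_pos (show k < i + 1 by omega), if_pos (show k + 1 < i + 1 by omega)]
      exact h.cell k
    · simp only [if_pos (show k < k + 1 by omega), if_neg (show ¬ k + 1 < k + 1 by omega)]
      rw [show k + 1 + (j - k) = j + 1 by omega, ← hc]
      exact h.cell k
    · simp only [if_neg (show ¬ k < i + 1 by omega), if_neg (show ¬ k + 1 < i + 1 by omega)]
      rw [show k + 1 + (j - i) = k + (j - i) + 1 by omega]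
      exact h.cell _

/-- A machine that runs in linear time on all inputs over `A` has crossing sequences of bounded
length: in a long input, at least half of the crossing sequences are short, so that two of them on
the same side of any given boundary agree, and the input can be shortened without losing the
crossing sequence at that boundary. -/
theorem LinearTime.exists_length_le {A : Set S} (hM : M.LinearTime A) :
    ∃ K, ∀ (x : List A) (b : ℕ → TapeSymbol S M.Work) (c : ℕ → List M.State),
      M.IsCrossing (M.initialTape (x.map Subtype.val)) b c → ∀ m, (c m).length ≤ K := by
  obtain ⟨k, hk⟩ := hM
  have := M.finite_state
  set κ := k + 1
  have hfin : {l : List M.State | l.length ≤ 2 * κ}.Finite := List.finite_length_le _ _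
  set F : Finset (List M.State × Bool) := hfin.toFinset ×ˢ Finset.univ
  refine ⟨κ * (2 * F.card), fun x => ?_⟩
  induction hn : x.length using Nat.strong_induction_on generalizing x with
  | _ n ih =>
    subst hn
    intro b c hc m
    obtain ⟨T, d, hd, -, -, hT⟩ := hc.exists_run
    have htime := hk x T d (reaches_iff_run.2 hd)
    have hle : ∀ N, ∑ i ∈ Finset.range N, (c i).length ≤ κ * (x.length + 1) := fun N => by
      refine (hT N).trans ?_
      rw [show κ = k + 1 from rfl, add_mul]
      omega
    set J := (Finset.range (x.length + 1)).filter fun i => (c (i + 1)).length ≤ 2 * κ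
    -- At most half of the boundaries have a crossing sequence longer than twice the average.
    have hJ : x.length + 1 ≤ 2 * J.card := by
      have hsplit := Finset.card_filter_add_card_filter_not (s := Finset.range (x.length + 1))
        (fun i => (c (i + 1)).length ≤ 2 * κ)
      rw [Finset.card_range] at hsplit
      set J' := (Finset.range (x.length + 1)).filter fun i => ¬ (c (i + 1)).length ≤ 2 * κ
      have h1 : J'.card * (2 * κ) ≤ ∑ i ∈ J', (c (i + 1)).length := by
        rw [← smul_eq_mul]
        refine Finset.card_nsmul_le_sum _ _ _ fun i hi => ?_
        have := (Finset.mem_filter.1 hi).2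
        omega
      have h2 : ∑ i ∈ J', (c (i + 1)).length ≤
          ∑ i ∈ Finset.range (x.length + 1), (c (i + 1)).length :=
        Finset.sum_le_sum_of_subset (Finset.filter_subset _ _)
      have h3 := hle (x.length + 2)
      rw [Finset.sum_range_succ'] at h3
      have h4 : κ * (2 * J'.card) ≤ κ * (x.length + 1) := by
        calc κ * (2 * J'.card) = J'.card * (2 * κ) := by ring
          _ ≤ _ := by omega
      have h5 := Nat.le_of_mul_le_mul_left h4 (Nat.succ_pos k)
      change J.card + J'.card = _ at hsplit
      omega
    by_cases hcard : J.card ≤ F.card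
    · calc (c m).length ≤ ∑ i ∈ Finset.range (m + 1), (c i).length :=
            Finset.single_le_sum (f := fun i => (c i).length) (fun _ _ => Nat.zero_le _)
              (Finset.self_mem_range_succ m)
        _ ≤ κ * (x.length + 1) := hle _
        _ ≤ _ := Nat.mul_le_mul_left _ (by omega)
    · obtain ⟨i, hi, j, hj, hne, heq⟩ := Finset.exists_ne_map_eq_of_card_lt_of_maps_to
        (s := J) (t := F) (f := fun i => (c (i + 1), decide (i + 1 < m))) (by omega)
        (fun i hi => by
          have := (Finset.mem_filter.1 hi).2
          exact Finset.mem_coe.2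
            (Finset.mem_product.2 ⟨hfin.mem_toFinset.2 this, Finset.mem_univ _⟩))
      wlog hij : i < j generalizing i j
      · exact this j hj i hi hne.symm heq.symm (by omega)
      obtain ⟨hcij, hside⟩ := Prod.mk.inj heq
      have hjx : j ≤ x.length := by
        have := (Finset.mem_filter.1 hj).1
        rw [Finset.mem_range] at this
        omega
      have hside : i + 1 < m ↔ j + 1 < m := by simpa using hside
      have hcut := hc.cut hij (by simpa using hjx) hcij
      rw [← List.map_take, ← List.map_drop, ← List.map_append] at hcut
      have hih := ih _ (by simp; omega) _ rfl _ _ hcut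
      by_cases hm : i + 1 < m
      · have := hih (m - (j - i))
        have hjm := hside.1 hm
        rwa [if_neg (by omega), show m - (j - i) + (j - i) = m by omega] at this
      · have := hih m
        rcases eq_or_lt_of_le (not_lt.1 hm) with rfl | hm'
        · rwa [if_neg (by omega), show i + 1 + (j - i) = j + 1 by omega, ← hcij] at this
        · rwa [if_pos hm'] at this

end OneTapeTM

/-! ### The convolution -/

section Convolution

variable {α β : Type*}

theorem length_conv (x : List α) (y : List β) : (conv x y).length = max x.length y.length := by
  simp [conv]

theorem getElem?_conv (x : List α) (y : List β) (i : ℕ) :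
    (conv x y)[i]? = if i < max x.length y.length then some (x[i]?, y[i]?) else none := by
  by_cases h : i < max x.length y.length
  · rw [if_pos h, List.getElem?_eq_getElem (by simpa [length_conv] using h)]
    simp [conv]
  · rw [if_neg h, List.getElem?_eq_none (by rw [length_conv]; omega)]

theorem conv_eq_cons (o : Option α) (o' : Option β) (h : o ≠ none ∨ o' ≠ none) (x : List α)
    (y : List β) (hx : o = none → x = []) (hy : o' = none → y = []) :
    conv (o.toList ++ x) (o'.toList ++ y) = (o, o') :: conv x y := by
  refine List.ext_getElem? fun i => ?_
  rw [getElem?_conv]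
  cases i with
  | zero =>
    rw [if_pos]
    · cases o <;> cases o' <;> simp_all
    · cases o <;> cases o' <;> simp_all
  | succ i =>
    rw [List.getElem?_cons_succ, getElem?_conv]
    cases o <;> cases o' <;> simp_all

theorem exists_option_toList (x : List α) :
    ∃ (o : Option α) (x' : List α), x = o.toList ++ x' ∧ (o = none → x' = []) := by
  cases x with
  | nil => exact ⟨none, [], rfl, fun _ => rfl⟩
  | cons a x => exact ⟨some a, x, rfl, nofun⟩

theorem getElem?_conv_fst (x : List α) (y : List β) (i : ℕ) :
    ((conv x y).map Prod.fst)[i]?.join = x[i]? := by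
  rw [List.getElem?_map, getElem?_conv]
  split_ifs with h
  · rfl
  · exact (List.getElem?_eq_none (by omega)).symm

theorem getElem?_conv_snd (x : List α) (y : List β) (i : ℕ) :
    ((conv x y).map Prod.snd)[i]?.join = y[i]? := by
  rw [List.getElem?_map, getElem?_conv]
  split_ifs with h
  · rfl
  · exact (List.getElem?_eq_none (by omega)).symm

end Convolution

/-! ### From machines to automata -/

/-- A union of members of a finite family of languages is regular if each quotient of a member by a
letter is a union of members. -/
theorem isRegular_of_finite_family {α σ : Type*} [Finite σ] (X : σ → Set (List α))
    (δ : σ → α → Set σ) (h : ∀ s a w, a :: w ∈ X s ↔ ∃ s' ∈ δ s a, w ∈ X s') (I : Set σ) :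
    Language.IsRegular {w | ∃ s ∈ I, w ∈ X s} := by
  classical
  have := Fintype.ofFinite σ
  let N : NFA α σ := ⟨δ, I, {s | [] ∈ X s}⟩
  have key : ∀ w (T : Set σ), w ∈ N.acceptsFrom T ↔ ∃ s ∈ T, w ∈ X s := by
    intro w
    induction w with
    | nil => intro T; exact N.nil_mem_acceptsFrom
    | cons a w ih =>
      intro T
      rw [NFA.cons_mem_acceptsFrom, ih]
      simp only [NFA.mem_stepSet, h]
      constructor
      · rintro ⟨s', ⟨s, hs, hs'⟩, hw⟩
        exact ⟨s, hs, s', hs', hw⟩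
      · rintro ⟨s, hs, s', hs', hw⟩
        exact ⟨s', ⟨s, hs, hs'⟩, hw⟩
  refine Language.isRegular_iff.2 ⟨Set σ, inferInstance, N.toDFA, ?_⟩
  rw [NFA.toDFA_correct, NFA.accepts_eq_acceptsFrom_start]
  ext w
  exact key w I

namespace OneTapeTM

variable {S : Type*} {M : OneTapeTM S}

/-- The content of a tape cell that holds a letter or, for `none`, the blank. -/
def cell {A : Set S} {W : Type*} (o : Option A) : TapeSymbol S W :=
  o.elim .blank fun a => .sym a

theorem cell_injective {A : Set S} {W : Type*} :
    Function.Injective (cell : Option A → TapeSymbol S W) := by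
  rintro (_ | a) (_ | b) h
  · rfl
  · cases h
  · cases h
  · exact congrArg some (Subtype.ext (TapeSymbol.sym.inj h))

theorem initialTape_map_succ {A : Set S} (x : List A) (i : ℕ) :
    M.initialTape (x.map Subtype.val) (i + 1) = cell x[i]? := by
  rw [initialTape_succ, List.getElem?_map]
  cases x[i]? <;> rfl

theorem hasOutput_map_iff {B : Set S} {c : M.Config} {y : List B} :
    M.HasOutput c (y.map Subtype.val) ↔
      c.tape 0 = .leftEnd ∧ ∀ i ≤ y.length, c.tape (i + 1) = cell y[i]? := by
  simp only [HasOutput, List.length_map, List.getElem_map]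
  refine and_congr_right fun _ => ⟨?_, ?_⟩
  · rintro ⟨h1, h2⟩ i hi
    rcases hi.lt_or_eq with hi | rfl
    · rw [h1 i hi, List.getElem?_eq_getElem hi]; rfl
    · rw [h2, List.getElem?_eq_none le_rfl]; rfl
  · intro h
    refine ⟨fun i hi => ?_, ?_⟩
    · rw [h i hi.le, List.getElem?_eq_getElem hi]; rfl
    · rw [h _ le_rfl, List.getElem?_eq_none le_rfl]; rfl

theorem HasOutput.unique {B : Set S} {c : M.Config} {y y' : List B}
    (h : M.HasOutput c (y.map Subtype.val)) (h' : M.HasOutput c (y'.map Subtype.val)) :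
    y = y' := by
  rw [hasOutput_map_iff] at h h'
  wlog hle : y.length ≤ y'.length generalizing y y'
  · exact (this h' h (by omega)).symm
  have heq : ∀ i ≤ y.length, y[i]? = y'[i]? := fun i hi =>
    cell_injective ((h.2 i hi).symm.trans (h'.2 i (hi.trans hle)))
  refine List.ext_getElem? fun i => ?_
  by_cases hi : i ≤ y.length
  · exact heq i hi
  · have hlen := heq y.length le_rfl
    rw [List.getElem?_eq_none le_rfl, eq_comm, List.getElem?_eq_none_iff] at hlen
    rw [List.getElem?_eq_none (by omega), List.getElem?_eq_none (by omega)]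

variable (M) in
/-- The convolutions of strings `x` and `y` for which the cells to the right of a boundary with
crossing sequence `l` can contain `x` at the beginning and `y` at the end of an accepting
computation, all crossing sequences being of length at most `K`. The first flag restricts `x` to be
empty. The second one says that `y` has ended further to the left, so that nothing is
required of the final tape content. -/
def tailLanguage (A B : Set S) (K : ℕ) (l : List M.State) (xd yd : Bool) :
    Set (List (Option A × Option B)) :=
  {w | ∃ (x : List A) (y : List B) (c : ℕ → List M.State) (b : ℕ → TapeSymbol S M.Work),
    (xd = true → x = []) ∧ (yd = true → y = []) ∧ w = conv x y ∧ c 0 = l ∧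
    (∃ N, ∀ i ≥ N, c i = []) ∧ (∀ i, (c i).length ≤ K) ∧
    (∀ i, M.Local .left (c i) (cell x[i]?) (c (i + 1)) (b i)) ∧
    (yd = false → ∀ i ≤ y.length, b i = cell y[i]?)}

theorem cons_mem_tailLanguage {A B : Set S} {K : ℕ} {l : List M.State} {xd yd : Bool}
    {o : Option A} {o' : Option B} {w : List (Option A × Option B)} :
    (o, o') :: w ∈ M.tailLanguage A B K l xd yd ↔
      ∃ l', (l.length ≤ K ∧ (o ≠ none ∨ o' ≠ none) ∧ (xd = true → o = none) ∧
          (yd = true → o' = none) ∧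
          ∃ b, M.Local .left l (cell o) l' b ∧ (yd = false → b = cell o')) ∧
        w ∈ M.tailLanguage A B K l' o.isNone o'.isNone := by
  constructor
  · rintro ⟨x, y, c, b, hx, hy, hw, rfl, ⟨N, hN⟩, hK, hc, hb⟩
    obtain ⟨p, x, rfl, hp⟩ := exists_option_toList x
    obtain ⟨p', y, rfl, hp'⟩ := exists_option_toList y
    have hne : p ≠ none ∨ p' ≠ none := by
      by_contra! hcon
      obtain ⟨rfl, rfl⟩ := hcon
      rw [hp rfl, hp' rfl] at hw
      cases hw
    rw [conv_eq_cons p p' hne x y hp hp'] at hw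
    obtain ⟨hpp, rfl⟩ := List.cons.inj hw
    obtain ⟨rfl, rfl⟩ := Prod.mk.inj hpp
    have h0 : (o.toList ++ x)[0]? = o := by cases o <;> simp_all
    have h0' : (o'.toList ++ y)[0]? = o' := by cases o' <;> simp_all
    have h1 : ∀ i, (o.toList ++ x)[i + 1]? = x[i]? := fun i => by cases o <;> simp_all
    have h1' : ∀ i, (o'.toList ++ y)[i + 1]? = y[i]? := fun i => by cases o' <;> simp_all
    refine ⟨c 1, ⟨hK 0, hne, fun h => ?_, fun h => ?_, b 0, ?_, fun h => ?_⟩, x, y,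
      fun i => c (i + 1), fun i => b (i + 1), ?_, ?_, rfl, rfl, ⟨N, fun i hi => hN _ (by omega)⟩,
      fun i => hK _, fun i => ?_, fun h i hi => ?_⟩
    · simpa using (List.append_eq_nil_iff.1 (hx h)).1
    · simpa using (List.append_eq_nil_iff.1 (hy h)).1
    · simpa [h0] using hc 0
    · simpa [h0'] using hb h 0 (Nat.zero_le _)
    · simpa using hp
    · simpa using hp'
    · simpa [h1] using hc (i + 1)
    · have hyd : yd = false := by
        by_contra hcon
        have := hy (by simpa using hcon)
        cases o' <;> simp_all
      have := hb hyd (i + 1) (by cases o' <;> simp_all)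
      rwa [h1'] at this
  · rintro ⟨l', ⟨hl, hne, hx, hy, b₀, hb₀, hy₀⟩, x, y, c, b, hx', hy', rfl, rfl, ⟨N, hN⟩, hK, hc,
      hb⟩
    have h1 : ∀ i, (o.toList ++ x)[i + 1]? = x[i]? := fun i => by cases o <;> simp_all
    have h1' : ∀ i, (o'.toList ++ y)[i + 1]? = y[i]? := fun i => by cases o' <;> simp_all
    have h0 : (o.toList ++ x)[0]? = o := by cases o <;> simp_all
    have h0' : (o'.toList ++ y)[0]? = o' := by cases o' <;> simp_all
    refine ⟨o.toList ++ x, o'.toList ++ y, fun i => i.casesOn l c, fun i => i.casesOn b₀ b,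
      fun h => ?_, fun h => ?_, ?_, rfl, ⟨N + 1, fun i hi => ?_⟩, fun i => ?_, fun i => ?_,
      fun h i hi => ?_⟩
    · have := hx h
      simp_all
    · have := hy h
      simp_all
    · rw [conv_eq_cons o o' hne x y (by simpa using hx') (by simpa using hy')]
    · cases i with
      | zero => omega
      | succ i => exact hN i (by omega)
    · cases i with
      | zero => exact hl
      | succ i => exact hK i
    · cases i with
      | zero => rw [h0]; exact hb₀
      | succ i => rw [h1]; exact hc i
    · cases i with
      | zero => rw [h0']; exact hy₀ h
      | succ i =>
        rw [h1']
        cases o' with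
        | none => simp_all
        | some a => exact hb rfl i (by simpa using hi)

/-- An accepting computation of `M` on `x` yields the value of the function computed by `M`. -/
theorem Computes.mem_iff {A B : Set S} {f : List A →. List B} (hM : M.Computes f) {x : List A}
    {y : List B} :
    y ∈ f x ↔ ∃ n c, M.Reaches (x.map Subtype.val) n c ∧ c.state ∈ M.accept ∧
      M.HasOutput c (y.map Subtype.val) := by
  obtain ⟨hdom, hout⟩ := hM x
  constructor
  · intro hy
    obtain ⟨n, c, hc, hacc⟩ := hdom.2 (Part.dom_iff_mem.2 ⟨y, hy⟩)
    exact ⟨n, c, hc, hacc, hout n c hc hacc y hy⟩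
  · rintro ⟨n, c, hc, hacc, ho⟩
    obtain ⟨y', hy'⟩ := Part.dom_iff_mem.1 (hdom.1 ⟨n, c, hc, hacc⟩)
    rwa [ho.unique (hout n c hc hacc y' hy')]

theorem Computes.isAutomatic {A B : Set S} {f : List A →. List B} (hM : M.Computes f)
    (hlin : M.LinearTime A) : IsAutomatic f := by
  obtain ⟨K, hK⟩ := hlin.exists_length_le
  have := M.finite_state
  have hfin : Finite {l : List M.State // l.length ≤ K} :=
    (List.finite_length_le M.State K).to_subtype
  have hreg := isRegular_of_finite_family
    (σ := {l : List M.State // l.length ≤ K} × Bool × Bool)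
    (fun s => M.tailLanguage A B K s.1 s.2.1 s.2.2)
    (fun s a => {s' | (s.1.1.length ≤ K ∧ (a.1 ≠ none ∨ a.2 ≠ none) ∧ (s.2.1 = true → a.1 = none) ∧
          (s.2.2 = true → a.2 = none) ∧
          ∃ b, M.Local .left s.1 (cell a.1) s'.1 b ∧ (s.2.2 = false → b = cell a.2)) ∧
          s'.2 = (a.1.isNone, a.2.isNone)})
    (by
      rintro ⟨⟨l, hl⟩, xd, yd⟩ ⟨o, o'⟩ w
      rw [cons_mem_tailLanguage]
      constructor
      · rintro ⟨l', h, hw⟩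
        have hl' : l'.length ≤ K := by
          obtain ⟨x, y, c, b, -, -, -, rfl, -, hK', -⟩ := hw
          exact hK' 0
        exact ⟨⟨⟨l', hl'⟩, o.isNone, o'.isNone⟩, ⟨h, rfl⟩, hw⟩
      · rintro ⟨⟨⟨l', hl'⟩, _⟩, ⟨h, rfl⟩, hw⟩
        exact ⟨l', h, hw⟩)
    {s | M.Local .left [M.start] .leftEnd s.1 .leftEnd ∧ s.2 = (false, false)}
  refine (congrArg Language.IsRegular (Set.ext fun w => ?_)).mp hreg
  constructor
  · rintro ⟨⟨⟨l, hl⟩, _⟩, ⟨hl0, rfl⟩, x, y, c, b, -, -, rfl, rfl, ⟨N, hN⟩, -, hc, hb⟩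
    refine ⟨x, y, ?_, rfl⟩
    have hcr : M.IsCrossing (M.initialTape (x.map Subtype.val)) (fun i => i.casesOn .leftEnd b)
        (fun i => i.casesOn [M.start] c) :=
      ⟨rfl, ⟨N + 1, fun i hi => by
          cases i with
          | zero => omega
          | succ i => exact hN i (by omega)⟩, fun i => by
          cases i with
          | zero => exact hl0
          | succ i =>
            rw [initialTape_map_succ]
            exact hc i⟩
    obtain ⟨m, d, hd, hacc, htape, -⟩ := hcr.exists_run
    refine hM.mem_iff.2 ⟨m, d, reaches_iff_run.2 hd, hacc, hasOutput_map_iff.2 ?_⟩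
    rw [htape]
    exact ⟨rfl, hb rfl⟩
  · rintro ⟨x, y, hy, rfl⟩
    obtain ⟨m, d, hd, hacc, ho⟩ := hM.mem_iff.1 hy
    obtain ⟨c, hc⟩ := (reaches_iff_run.1 hd).exists_isCrossing hacc
    have hK' := hK x _ c hc
    rw [hasOutput_map_iff] at ho
    obtain ⟨N, hN⟩ := hc.eventually
    refine ⟨⟨⟨c 1, hK' 1⟩, false, false⟩, ⟨?_, rfl⟩, x, y, fun i => c (i + 1),
      fun i => d.tape (i + 1), nofun, nofun, rfl, rfl, ⟨N, fun i hi => hN _ (by omega)⟩,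
      fun i => hK' _, fun i => ?_, fun _ => ho.2⟩
    · have := hc.cell 0
      rwa [hc.zero, ho.1] at this
    · rw [← initialTape_map_succ]
      exact hc.cell _

end OneTapeTM

/-! ### From automata to machines -/

section ConvolutionWords

variable {α β : Type*}

/-- The part of a word over pairs that reads the letters of the first string. -/
def headWord (w : List (α × Option β)) : List (Option α × Option β) :=
  w.map fun r => (some r.1, r.2)

/-- The part of a convolution beyond the end of the first string, `t` being the rest of the second
string. -/
def tailWord (t : List β) : List (Option α × Option β) :=
  t.map fun b => (none, some b)

theorem exists_conv_eq_append (x : List α) (y : List β) :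
    ∃ (w : List (α × Option β)) (t : List β), w.map Prod.fst = x ∧
      conv x y = headWord w ++ tailWord t := by
  induction x generalizing y with
  | nil =>
    refine ⟨[], y, rfl, List.ext_getElem? fun i => ?_⟩
    simp only [getElem?_conv, headWord, tailWord, List.map_nil, List.nil_append,
      List.getElem?_map, List.length_nil, Nat.zero_max, List.getElem?_nil]
    split_ifs with h
    · simp [h]
    · rw [List.getElem?_eq_none (l := y) (by omega)]; rfl
  | cons a x ih =>
    obtain ⟨o, y, rfl, ho⟩ := exists_option_toList y
    obtain ⟨w, t, rfl, hw⟩ := ih y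
    refine ⟨(a, o) :: w, t, rfl, ?_⟩
    have := conv_eq_cons (some a) o (.inl nofun) (w.map Prod.fst) y nofun ho
    rw [hw] at this
    exact this

/-- The two strings can be read off a word that is known to be a convolution. -/
theorem getElem?_of_append_eq_conv {w : List (α × Option β)} {t : List β} {x : List α} {y : List β}
    (h : headWord w ++ tailWord t = conv x y) :
    w.map Prod.fst = x ∧ ∀ i : ℕ, (w.map Prod.snd ++ t.map some)[i]?.join = y[i]? := by
  refine ⟨List.ext_getElem? fun i => ?_, fun i => ?_⟩
  · rw [← getElem?_conv_fst x y, ← h]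
    simp only [headWord, tailWord, List.map_append, List.map_map, List.getElem?_append,
      List.length_map, List.getElem?_map]
    split_ifs with hi
    · simp [hi]
    · rw [List.getElem?_eq_none (l := w) (by omega)]
      cases t[i - w.length]? <;> rfl
  · rw [← getElem?_conv_snd x y, ← h]
    simp [headWord, tailWord, Function.comp_def]

end ConvolutionWords

namespace OneTapeTM

/-- A deterministic machine halts in a single configuration, after a fixed number of steps. -/
theorem IsDeterministic.run_le {S : Type*} {M : OneTapeTM S} (hM : M.IsDeterministic) {T n : ℕ}
    {c d d' : M.Config} (h : M.Run T c d) (hd : ∀ e, ¬ M.Step d e) (h' : M.Run n c d') :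
    n ≤ T ∧ ((∀ e, ¬ M.Step d' e) → d' = d) := by
  induction h generalizing n with
  | refl c =>
    cases h' with
    | refl => exact ⟨le_rfl, fun _ => rfl⟩
    | head hs _ => exact absurd hs (hd _)
  | @head T c e d hs _ ih =>
    cases h' with
    | refl => exact ⟨Nat.zero_le _, fun hhalt => absurd hs (hhalt _)⟩
    | @head n _ e' _ hs' hr' =>
      have heq : e' = e := by
        obtain ⟨p, k, t⟩ := e
        obtain ⟨p', k', t'⟩ := e'
        obtain ⟨-, b, m, htr, ht, hk⟩ := hs
        obtain ⟨-, b', m', htr', ht', hk'⟩ := hs'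
        dsimp only at *
        obtain ⟨rfl, rfl, rfl⟩ := hM _ _ _ _ _ _ _ _ htr htr'
        subst ht ht' hk hk'
        rfl
      subst heq
      have := ih hd hr'
      exact ⟨by omega, this.2⟩

theorem not_step_of_accept {S : Type*} {M : OneTapeTM S} {c : M.Config} (h : c.state ∈ M.accept)
    (d : M.Config) : ¬ M.Step c d := fun hs => hs.1 h

/-- The tape that holds the list `l`, followed by blanks. -/
def tapeOf {S W : Type*} (l : List (TapeSymbol S W)) (i : ℕ) : TapeSymbol S W :=
  l[i]?.getD .blank

section TapeOf

variable {S W : Type*} (l r : List (TapeSymbol S W)) (s b : TapeSymbol S W)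

theorem tapeOf_length : tapeOf (l ++ s :: r) l.length = s := by simp [tapeOf]

theorem update_tapeOf_length :
    Function.update (tapeOf (l ++ s :: r)) l.length b = tapeOf (l ++ b :: r) := by
  funext i
  rcases lt_trichotomy i l.length with hi | rfl | hi
  · rw [Function.update_of_ne hi.ne, tapeOf, tapeOf, List.getElem?_append_left hi,
      List.getElem?_append_left hi]
  · rw [Function.update_self, tapeOf_length]
  · obtain ⟨k, rfl⟩ := Nat.exists_eq_add_of_lt hi
    rw [Function.update_of_ne hi.ne', tapeOf, tapeOf, List.getElem?_append_right (by omega),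
      List.getElem?_append_right (by omega),
      show l.length + k + 1 - l.length = k + 1 by omega]
    rfl

theorem tapeOf_append_blank : tapeOf (l ++ [.blank]) = tapeOf l := by
  funext i
  rcases lt_trichotomy i l.length with hi | rfl | hi
  · rw [tapeOf, tapeOf, List.getElem?_append_left hi]
  · rw [tapeOf_length, tapeOf, List.getElem?_eq_none le_rfl]; rfl
  · rw [tapeOf, tapeOf, List.getElem?_eq_none hi.le, List.getElem?_eq_none (by simpa using hi)]

end TapeOf

/-- The states of the machine that computes an automatic function whose automaton has the states
`σ`. Letters are encoded in `Λ`, and `N` bounds the number of letters by which the value can be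
longer than the argument. -/
inductive PassState (σ Λ : Type) (N : ℕ) : Type
  /-- moving right; the set contains the states which the automaton can have reached -/
  | forward (P : Set σ)
  /-- writing the given letters to the right of the input, before going back from state `p` -/
  | tail (p : σ) (t : {t : List Λ // t.length ≤ N})
  /-- moving left; the automaton is in state `p` on a run that will be accepted -/
  | back (p : σ)
  /-- accepting -/
  | done

instance {σ Λ : Type} [Finite σ] [Finite Λ] (N : ℕ) : Finite (PassState σ Λ N) := by
  have : Finite {t : List Λ // t.length ≤ N} := (List.finite_length_le Λ N).to_subtype
  refine Finite.of_surjective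
    (Sum.elim PassState.forward (Sum.elim (fun r : σ × {t : List Λ // t.length ≤ N} =>
      PassState.tail r.1 r.2) (Sum.elim PassState.back fun _ : Unit => PassState.done))) ?_
  rintro (P | ⟨p, t⟩ | p | _)
  · exact ⟨.inl P, rfl⟩
  · exact ⟨.inr (.inl (p, t)), rfl⟩
  · exact ⟨.inr (.inr (.inl p)), rfl⟩
  · exact ⟨.inr (.inr (.inr ())), rfl⟩

section PassMachine

variable {S : Type*} {A B : Set S} {σ Λ : Type} (e : S ≃ Λ) (D : DFA (Option A × Option B) σ)
  (N : ℕ)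

/-- The states reachable from `P` by reading the letter `s` of the argument and any letter of the
value. -/
def next (P : Set σ) (s : S) : Set σ :=
  {q | ∃ p ∈ P, ∃ (h : s ∈ A) (o : Option B), D.step p (some ⟨s, h⟩, o) = q}

open Classical in
/-- A state in `P` and a letter of the value that lead to `q` if the argument has the letter `s`
there (a junk value if `q` is not in `next D P s`). -/
noncomputable def prev (P : Set σ) (s : S) (q : σ) : σ × Option B :=
  if h : ∃ r : σ × Option B, r.1 ∈ P ∧ ∃ h : s ∈ A, D.step r.1 (some ⟨s, h⟩, r.2) = q then h.choose
  else (q, none)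

theorem prev_spec {P : Set σ} {a : A} {q : σ} (hq : q ∈ next D P a) :
    (prev D P a q).1 ∈ P ∧ D.step (prev D P a q).1 (some a, (prev D P a q).2) = q := by
  obtain ⟨p, hp, h, o, ho⟩ := hq
  have hex : ∃ r : σ × Option B, r.1 ∈ P ∧ ∃ h : a.1 ∈ A, D.step r.1 (some ⟨a.1, h⟩, r.2) = q :=
    ⟨(p, o), hp, h, ho⟩
  rw [prev, dif_pos hex]
  exact ⟨hex.choose_spec.1, hex.choose_spec.2.2⟩

open Classical in
/-- A state in `P` and at most `N` final letters of the value that lead from this state to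
acceptance. -/
noncomputable def finish (P : Set σ) : Option (σ × {t : List B // t.length ≤ N}) :=
  if h : ∃ r : σ × {t : List B // t.length ≤ N},
      r.1 ∈ P ∧ D.evalFrom r.1 (tailWord r.2.1) ∈ D.accept then some h.choose
  else none

theorem finish_eq_some {P : Set σ} {r : σ × {t : List B // t.length ≤ N}}
    (h : finish D N P = some r) : r.1 ∈ P ∧ D.evalFrom r.1 (tailWord r.2.1) ∈ D.accept := by
  unfold finish at h
  split_ifs at h with hex
  rw [← Option.some.inj h]
  exact hex.choose_spec

theorem finish_eq_none {P : Set σ} (h : finish D N P = none) {p : σ} (hp : p ∈ P) {t : List B}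
    (ht : t.length ≤ N) : D.evalFrom p (tailWord t) ∉ D.accept := fun hacc => by
  unfold finish at h
  rw [dif_pos ⟨(p, ⟨t, ht⟩), hp, hacc⟩] at h
  cases h

/-- The transition function of `passMachine`. -/
noncomputable def passStep : PassState σ Λ N → TapeSymbol S (Set σ × Λ) →
    Option (PassState σ Λ N × TapeSymbol S (Set σ × Λ) × Move)
  | .forward P, .leftEnd => some (.forward P, .leftEnd, .right)
  | .forward P, .sym s => some (.forward (next D P s), .work (P, e s), .right)
  | .forward P, .blank => (finish D N P).map fun r =>
      (.tail r.1 ⟨r.2.1.map fun b : B => e b, by simpa using r.2.2⟩, .blank, .stay)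
  | .tail p ⟨[], _⟩, .blank => some (.back p, .blank, .stay)
  | .tail p ⟨k :: t, h⟩, .blank =>
      some (.tail p ⟨t, (Nat.le_succ _).trans h⟩, .sym (e.symm k), .right)
  | .back q, .work w =>
      some (.back (prev D w.1 (e.symm w.2) q).1, cell (prev D w.1 (e.symm w.2) q).2, .left)
  | .back q, .sym s => some (.back q, .sym s, .left)
  | .back q, .blank => some (.back q, .blank, .left)
  | .back _, .leftEnd => some (.done, .leftEnd, .stay)
  | _, _ => none

/-- The machine that computes an automatic function. It simulates all runs of the automaton at once,
storing in each cell the set of the states reachable before this cell. At the end of the input it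
selects an accepting run, writes the letters of the value that lie beyond the input, and then goes
back to the left, reconstructing the run and replacing each letter of the argument by the
corresponding letter of the value. -/
noncomputable def passMachine [Finite σ] [Finite Λ] : OneTapeTM S where
  Work := Set σ × Λ
  State := PassState σ Λ N
  finite_work := inferInstance
  finite_state := inferInstance
  start := .forward {D.start}
  accept := {.done}
  trans q a p b d := passStep e D N q a = some (p, b, d)
  leftEnd_iff q a p b d h := by
    unfold passStep at h
    split at h
    case h_3 =>
      obtain ⟨r, -, hr⟩ := Option.map_eq_some_iff.1 h
      simp only [Prod.mk.injEq] at hr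
      simp [← hr.2.1]
    case h_6 w =>
      simp only [Option.some.injEq, Prod.mk.injEq] at h
      rw [← h.2.1]
      cases (prev D w.1 (e.symm w.2) _).2 <;> simp [cell]
    all_goals simp_all
    all_goals simp [← h.2.1]
  not_left q p b h := by
    unfold passStep at h
    split at h <;> simp_all

/-- The states reachable from `P` by reading `x` together with any value. -/
def reach (P : Set σ) (x : List A) : Set σ :=
  x.foldl (fun P a => next D P a) P

theorem evalFrom_mem_reach {P : Set σ} {p : σ} (hp : p ∈ P) (w : List (A × Option B)) :
    D.evalFrom p (headWord w) ∈ reach D P (w.map Prod.fst) := by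
  induction w generalizing P p with
  | nil => exact hp
  | cons r w ih => exact ih (P := next D P r.1.1) ⟨p, hp, r.1.2, r.2, rfl⟩

/-- What the cells of the input `x` contain after the pass to the right, which starts with the
set `P`. -/
def annotate : Set σ → List A → List (TapeSymbol S (Set σ × Λ))
  | _, [] => []
  | P, a :: x => .work (P, e a) :: annotate (next D P a) x

theorem length_annotate (P : Set σ) (x : List A) : (annotate e D P x).length = x.length := by
  induction x generalizing P with
  | nil => rfl
  | cons a x ih => simp [annotate, ih]

variable [Finite σ] [Finite Λ]

theorem passMachine_isDeterministic : (passMachine e D N).IsDeterministic := by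
  intro q a p b d p' b' d' h h'
  have := Option.some.inj (h.symm.trans h')
  exact ⟨congrArg Prod.fst this, congrArg (fun r => r.2.1) this, congrArg (fun r => r.2.2) this⟩

/-- The configuration of `passMachine` with the given components. -/
def passConfig (q : PassState σ Λ N) (h : ℕ) (t : ℕ → TapeSymbol S (Set σ × Λ)) :
    (passMachine e D N).Config :=
  ⟨q, h, t⟩

variable {e D N}

theorem passMachine_run_one {q p : PassState σ Λ N} {s b : TapeSymbol S (Set σ × Λ)} {d : Move}
    (h : passStep e D N q s = some (p, b, d)) (hq : q ≠ .done)
    (l r : List (TapeSymbol S (Set σ × Λ))) :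
    (passMachine e D N).Run 1 (passConfig e D N q l.length (tapeOf (l ++ s :: r)))
      (passConfig e D N p (d.apply l.length) (tapeOf (l ++ b :: r))) := by
  refine .single ⟨hq, b, d, ?_, (update_tapeOf_length _ _ _ _).symm, rfl⟩
  change passStep e D N q (tapeOf (l ++ s :: r) l.length) = _
  rwa [tapeOf_length]

theorem passMachine_run_forward (P : Set σ) (x : List A) (l : List (TapeSymbol S (Set σ × Λ))) :
    (passMachine e D N).Run x.length
      (passConfig e D N (.forward P) (l.length) (tapeOf (l ++ x.map fun a : A => .sym a.1)))
      (passConfig e D N (.forward (reach D P x)) (l.length + x.length)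
        (tapeOf (l ++ annotate e D P x))) := by
  induction x generalizing P l with
  | nil => exact .refl _
  | cons a x ih =>
    have h1 : (passMachine e D N).Run 1 _ _ := passMachine_run_one (e := e) (D := D) (N := N)
      (q := .forward P) (s := .sym a.1) rfl nofun l (x.map fun a : A => .sym a.1)
    have h2 := ih (next D P a) (l ++ [.work (P, e a)])
    simp only [List.append_assoc, List.singleton_append, List.length_append,
      List.length_singleton] at h2
    have := h1.trans h2
    rw [add_comm, add_right_comm, add_assoc] at this
    exact this

theorem passMachine_run_tail (p : σ) (t : List Λ) (ht : t.length ≤ N)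
    (l : List (TapeSymbol S (Set σ × Λ))) :
    (passMachine e D N).Run t.length (passConfig e D N (.tail p ⟨t, ht⟩) (l.length) (tapeOf l))
      (passConfig e D N (.tail p ⟨[], Nat.zero_le _⟩) (l.length + t.length)
        (tapeOf (l ++ t.map fun k : Λ => .sym (e.symm k)))) := by
  induction t generalizing l with
  | nil =>
    rw [List.map_nil, List.append_nil]
    exact .refl _
  | cons k t ih =>
    have h1 : (passMachine e D N).Run 1 _ _ := passMachine_run_one (e := e) (D := D) (N := N)
      (q := .tail p ⟨k :: t, ht⟩) (s := .blank) rfl nofun l []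
    have h2 := ih ((Nat.le_succ _).trans ht) (l ++ [.sym (e.symm k)])
    rw [tapeOf_append_blank] at h1
    simp only [List.append_assoc, List.singleton_append, List.length_append,
      List.length_singleton] at h2
    have := h1.trans h2
    rw [add_comm, add_right_comm, add_assoc] at this
    exact this

/-- On its way back, the machine leaves the cells beyond the input unchanged. -/
theorem passMachine_run_back_tail (q : σ) (h m : ℕ) (t : ℕ → TapeSymbol S (Set σ × Λ))
    (ht : ∀ i, h < i → t i = .blank ∨ ∃ s, t i = .sym s) :
    (passMachine e D N).Run m (passConfig e D N (.back q) (h + m) t)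
      (passConfig e D N (.back q) h t) := by
  induction m with
  | zero => exact .refl _
  | succ m ih =>
    refine .head (c' := passConfig e D N (.back q) (h + m) t)
      ⟨nofun, t (h + m + 1), .left, ?_, (Function.update_eq_self _ _).symm, rfl⟩ ih
    change passStep e D N (.back q) (t (h + m + 1)) = _
    rcases ht (h + m + 1) (by omega) with h' | ⟨s, h'⟩ <;> rw [h'] <;> rfl

theorem passMachine_run_back (P : Set σ) (x : List A) (q : σ) (hq : q ∈ reach D P x)
    (l r : List (TapeSymbol S (Set σ × Λ))) (z : TapeSymbol S (Set σ × Λ)) :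
    ∃ w : List (A × Option B), w.map Prod.fst = x ∧ ∃ p ∈ P, D.evalFrom p (headWord w) = q ∧
      (passMachine e D N).Run x.length
        (passConfig e D N (.back q) (l.length + x.length)
          (tapeOf (l ++ z :: (annotate e D P x ++ r))))
        (passConfig e D N (.back p) l.length
          (tapeOf (l ++ z :: ((w.map fun r => cell r.2) ++ r)))) := by
  induction x generalizing P l z with
  | nil => exact ⟨[], rfl, q, hq, rfl, .refl _⟩
  | cons a x ih =>
    obtain ⟨w, hw, p, hp, hpq, hrun⟩ := ih (next D P a) hq (l ++ [z]) (.work (P, e a))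
    obtain ⟨hp', hstep⟩ := prev_spec D hp
    refine ⟨(a, (prev D P a p).2) :: w, by rw [List.map_cons, hw], _, hp', ?_, ?_⟩
    · rw [headWord, List.map_cons, DFA.evalFrom_cons, hstep]
      exact hpq
    · have h1 : (passMachine e D N).Run 1 _ _ := passMachine_run_one (e := e) (D := D) (N := N)
        (q := .back p) (s := .work (P, e a)) rfl nofun (l ++ [z])
        ((w.map fun r => cell r.2) ++ r)
      have h2 := hrun.trans h1
      simp only [List.append_assoc, List.singleton_append, List.length_append,
        List.length_singleton, Equiv.symm_apply_apply, Move.apply, Nat.add_sub_cancel] at h2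
      rw [add_assoc, add_comm 1] at h2
      exact h2

theorem passMachine_initialTape (x : List A) :
    (passMachine e D N).initialTape (x.map Subtype.val) =
      tapeOf (.leftEnd :: x.map fun a : A => .sym a.1) := by
  funext i
  cases i with
  | zero => rfl
  | succ i =>
    rw [initialTape_map_succ, tapeOf, List.getElem?_cons_succ, List.getElem?_map]
    cases x[i]? <;> rfl

theorem passMachine_run_input (x : List A) :
    (passMachine e D N).Run (x.length + 1)
      ((passMachine e D N).initialConfig (x.map Subtype.val))
      (passConfig e D N (.forward (reach D {D.start} x)) (x.length + 1)
        (tapeOf (.leftEnd :: annotate e D {D.start} x))) := by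
  have h1 : (passMachine e D N).Run 1 _ _ := passMachine_run_one (e := e) (D := D) (N := N)
    (q := .forward {D.start}) (s := .leftEnd) rfl nofun [] (x.map fun a : A => .sym a.1)
  have h2 := h1.trans (passMachine_run_forward {D.start} x [.leftEnd])
  rw [initialConfig, passMachine_initialTape]
  rw [add_comm, List.length_singleton, add_comm 1] at h2
  exact h2

/-- If no value exists, then the machine gets stuck after its pass to the right. -/
theorem passMachine_run_of_finish_eq_none (x : List A)
    (h : finish D N (reach D {D.start} x) = none) :
    ∃ c, (passMachine e D N).Run (x.length + 1)
      ((passMachine e D N).initialConfig (x.map Subtype.val)) c ∧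
      (∀ d, ¬ (passMachine e D N).Step c d) ∧ c.state ∉ (passMachine e D N).accept := by
  refine ⟨_, passMachine_run_input x, ?_, nofun⟩
  rintro d ⟨-, b, m, htr, -⟩
  change passStep e D N (.forward (reach D {D.start} x)) (tapeOf _ (x.length + 1)) = _ at htr
  rw [tapeOf, List.getElem?_eq_none (by simp [length_annotate])] at htr
  simp [passStep, h] at htr

/-- If a value exists, then the machine accepts, and its tape content describes an accepting run of
the automaton. -/
theorem passMachine_run_of_finish_eq_some (x : List A)
    {r : σ × {t : List B // t.length ≤ N}}
    (h : finish D N (reach D {D.start} x) = some r) :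
    ∃ (w : List (A × Option B)) (t : List B), w.map Prod.fst = x ∧ t.length ≤ N ∧
      headWord w ++ tailWord t ∈ D.accepts ∧
      (passMachine e D N).Run (2 * x.length + 2 * t.length + 5)
        ((passMachine e D N).initialConfig (x.map Subtype.val))
        (passConfig e D N .done 0
          (tapeOf (.leftEnd :: ((w.map fun r => cell r.2) ++ t.map fun b : B => .sym b.1)))) := by
  obtain ⟨q, t, ht⟩ := r
  obtain ⟨hq, hacc⟩ := finish_eq_some D N h
  obtain ⟨w, hw, p, hp, hpq, hrun⟩ := passMachine_run_back (e := e) (N := N) {D.start} x q hq []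
    (t.map fun b : B => .sym b.1) .leftEnd
  rw [Set.mem_singleton_iff] at hp
  subst hp
  refine ⟨w, t, hw, ht, ?_, ?_⟩
  · rw [DFA.mem_accepts, DFA.eval, DFA.evalFrom_of_append, hpq]
    exact hacc
  · set l := TapeSymbol.leftEnd :: annotate e D {D.start} x with hl
    have hlen : l.length = x.length + 1 := by simp [hl, length_annotate]
    have h1 : (passMachine e D N).Run 1 _ _ := passMachine_run_one (e := e) (D := D) (N := N)
      (q := .forward (reach D {D.start} x)) (s := .blank) (by rw [passStep, h]; rfl) nofun l []
    have h2 := passMachine_run_tail (e := e) (D := D) (N := N) q (t.map fun b : B => e b)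
      (by simpa using ht) l
    simp only [List.length_map, List.map_map, Function.comp_def, Equiv.symm_apply_apply] at h2
    have h3 : (passMachine e D N).Run 1 _ _ := passMachine_run_one (e := e) (D := D) (N := N)
      (q := .tail q ⟨[], Nat.zero_le _⟩) (s := .blank) rfl nofun
      (l ++ t.map fun b : B => .sym b.1) []
    have h4 := passMachine_run_back_tail (e := e) (D := D) (N := N) q x.length (t.length + 1)
      (tapeOf (l ++ t.map fun b : B => .sym b.1)) (fun i hi => by
        rw [tapeOf, List.getElem?_append_right (by omega), List.getElem?_map]
        cases t[i - l.length]? with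
        | none => exact .inl rfl
        | some b => exact .inr ⟨b.1, rfl⟩)
    have h5 : (passMachine e D N).Run 1 _ _ := passMachine_run_one (e := e) (D := D) (N := N)
      (q := .back D.start) (s := .leftEnd) rfl nofun []
      ((w.map fun r => cell r.2) ++ t.map fun b : B => .sym b.1)
    rw [tapeOf_append_blank] at h1 h3
    simp only [Move.apply, List.length_append, List.length_map, hlen] at h1 h2 h3
    rw [show x.length + 1 + t.length = x.length + (t.length + 1) by omega] at h2 h3
    simp only [List.nil_append, List.length_nil, Nat.zero_add] at hrun
    have := (passMachine_run_input x).trans (h1.trans (h2.trans (h3.trans (h4.trans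
      (hrun.trans h5)))))
    rw [show x.length + 1 + (1 + (t.length + (1 + (t.length + 1 + (x.length + 1))))) =
      2 * x.length + 2 * t.length + 5 by omega] at this
    exact this

end PassMachine

end OneTapeTM

open OneTapeTM in
/-- An automatic function is computed by a deterministic machine in linear time. -/
theorem IsAutomatic.detLinearTimeComputable {S : Type*} [Finite S] {A B : Set S}
    {f : List A →. List B} (hf : IsAutomatic f) : DetLinearTimeComputable f := by
  obtain ⟨σ, _, D, hD⟩ := hf
  obtain ⟨n, ⟨e⟩⟩ := Finite.exists_equiv_fin S
  -- For each state that can be accepted while the argument is exhausted, one tail suffices.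
  obtain ⟨N, hN⟩ : ∃ N, ∀ (p : σ) (t : List B), D.evalFrom p (tailWord t) ∈ D.accept →
      ∃ t' : List B, t'.length ≤ N ∧ D.evalFrom p (tailWord t') ∈ D.accept := by
    have hex : ∀ p : σ, ∃ m, ∀ t : List B, D.evalFrom p (tailWord t) ∈ D.accept →
        ∃ t' : List B, t'.length ≤ m ∧ D.evalFrom p (tailWord t') ∈ D.accept := fun p => by
      by_cases h : ∃ t : List B, D.evalFrom p (tailWord t) ∈ D.accept
      · obtain ⟨t, ht⟩ := h
        exact ⟨t.length, fun _ _ => ⟨t, le_rfl, ht⟩⟩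
      · exact ⟨0, fun t ht => absurd ⟨t, ht⟩ h⟩
    choose g hg using hex
    refine ⟨Finset.univ.sup g, fun p t ht => ?_⟩
    obtain ⟨t', ht', hacc⟩ := hg p t ht
    exact ⟨t', ht'.trans (Finset.le_sup (Finset.mem_univ p)), hacc⟩
  have hdet := passMachine_isDeterministic e D N
  refine ⟨passMachine e D N, hdet, fun x => ?_, 2 * N + 5, fun x m c hc => ?_⟩
  · cases h : finish D N (reach D {D.start} x) with
    | none =>
      obtain ⟨d, hd, hhalt, hacc⟩ := passMachine_run_of_finish_eq_none (e := e) x h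
      have hno : ∀ m c, (passMachine e D N).Reaches (x.map Subtype.val) m c →
          c.state ∉ (passMachine e D N).accept := fun m c hc hcacc => by
        rw [(hdet.run_le hd hhalt (reaches_iff_run.1 hc)).2 (not_step_of_accept hcacc)] at hcacc
        exact hacc hcacc
      refine ⟨⟨fun ⟨m, c, hc, hcacc⟩ => absurd hcacc (hno m c hc), fun hdom => ?_⟩,
        fun m c hc hcacc => absurd hcacc (hno m c hc)⟩
      exfalso
      obtain ⟨y, hy⟩ := Part.dom_iff_mem.1 hdom
      obtain ⟨w, t, rfl, hw⟩ := exists_conv_eq_append x y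
      have hmem : conv (w.map Prod.fst) y ∈ D.accepts := by
        rw [hD]
        exact ⟨_, y, hy, rfl⟩
      rw [hw, DFA.mem_accepts, DFA.eval, DFA.evalFrom_of_append] at hmem
      obtain ⟨t', ht', hacc'⟩ := hN _ t hmem
      exact finish_eq_none D N h (evalFrom_mem_reach D (Set.mem_singleton _) w) ht' hacc'
    | some r =>
      obtain ⟨w, t, hw, ht, hmem, hrun⟩ := passMachine_run_of_finish_eq_some (e := e) x h
      rw [hD] at hmem
      obtain ⟨x', y, hy, hxy⟩ := hmem
      obtain ⟨hwx, hwy⟩ := getElem?_of_append_eq_conv hxy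
      obtain rfl : x = x' := hw.symm.trans hwx
      refine ⟨⟨fun _ => Part.dom_iff_mem.2 ⟨y, hy⟩,
        fun _ => ⟨_, _, reaches_iff_run.2 hrun, rfl⟩⟩, fun m c hc hcacc y' hy' => ?_⟩
      rw [(hdet.run_le hrun (not_step_of_accept rfl) (reaches_iff_run.1 hc)).2
        (not_step_of_accept hcacc), Part.mem_unique hy' hy, hasOutput_map_iff]
      refine ⟨rfl, fun i _ => ?_⟩
      change tapeOf (_ :: _) (i + 1) = _
      rw [← hwy i, tapeOf, List.getElem?_cons_succ, List.getElem?_append, List.getElem?_append]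
      simp only [List.length_map, List.getElem?_map]
      split_ifs with hi
      · rw [List.getElem?_eq_getElem hi]
        rfl
      · cases t[i - w.length]? <;> rfl
  · rw [reaches_iff_run] at hc
    -- Both passes visit each cell of the argument once, and at most `N` cells beyond it.
    have hle : m ≤ 2 * x.length + 2 * N + 5 := by
      cases h : finish D N (reach D {D.start} x) with
      | none =>
        obtain ⟨d, hd, hhalt, -⟩ := passMachine_run_of_finish_eq_none (e := e) x h
        have := (hdet.run_le hd hhalt hc).1
        omega
      | some r =>
        obtain ⟨w, t, -, ht, -, hrun⟩ := passMachine_run_of_finish_eq_some (e := e) x h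
        have := (hdet.run_le hrun (not_step_of_accept rfl) hc).1
        omega
    calc m ≤ 2 * x.length + 2 * N + 5 := hle
      _ ≤ 2 * x.length + 2 * N + 5 + (2 * (N * x.length) + 3 * x.length) := Nat.le_add_right _ _
      _ = (2 * N + 5) * (x.length + 1) := by ring

theorem theorem2p5 {S : Type*} [Finite S] (A B : Set S) (f : List A →. List B) :
    (NondetLinearTimeComputable f → IsAutomatic f) ∧
    List.TFAE [IsAutomatic f, DetLinearTimeComputable f, NondetLinearTimeComputable f] := by
  have h : NondetLinearTimeComputable f → IsAutomatic f :=
    fun ⟨_, hM, hlin⟩ => hM.isAutomatic hlin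
  refine ⟨h, ?_⟩
  tfae_have 1 → 2 := fun hf => hf.detLinearTimeComputable
  tfae_have 2 → 3 := fun ⟨M, _, hM, hlin⟩ => ⟨M, hM, hlin⟩
  tfae_have 3 → 1 := h
  tfae_finish
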